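/- For a graph $G$ and an integer $m\ge 0$, let $N_m(G)$ be the multineighbor complex of $G$: the simplicial complex whose simplices are the nonempty finite sets of vertices of $G$ that have at least $m$ common neighbors in $G$. Let $G(n,1/2)$ be the random graph on $n$ labelled vertices in which each edge appears independently with probability $1/2$. Fix an integer $m\ge 0$, a real number $\varepsilon>0$ and an abelian group $A$. Then, asymptotically almost surely, the simplicial homology satisfies $H_{l-m+1}(N_m(G(n,1/2));A)=0$ for all $l\ge(4+\varepsilon)\log_2 n$; that is, $$\lim_{n\to\infty}\mathbb P\Bigl(H_{l-m+1}\bigl(N_m(G(n,1/2));A\bigr)=0\ \text{ for every integer } l\ge(4+\varepsilon)\log_2 n\Bigr)=1 .$$ -/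

import Mathlib

section SimplicialHomology

variable {V : Type*} [LinearOrder V]

/-- The `q`-simplices of an abstract simplicial complex: its faces with `q + 1` vertices. -/
def PreAbstractSimplicialComplex.Simplex (K : PreAbstractSimplicialComplex V) (q : ℕ) : Type _ :=
  {s : Finset V // s ∈ K.faces ∧ s.card = q + 1}

/-- The face of a `(q + 1)`-simplex opposite to its vertex `v`. -/
def PreAbstractSimplicialComplex.Simplex.face {K : PreAbstractSimplicialComplex V} {q : ℕ}
    (s : K.Simplex (q + 1)) (v : {x // x ∈ s.1}) : K.Simplex q :=
  have hcard : (s.1.erase v.1).card = q + 1 := by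
    rw [Finset.card_erase_of_mem v.2, s.2.2]; rfl
  ⟨s.1.erase v.1,
    (K.isRelLowerSet_faces s.2.1).2 (Finset.erase_subset v.1 s.1)
      (Finset.card_pos.1 (by rw [hcard]; exact Nat.succ_pos q)),
    hcard⟩

/-- The group of simplicial `q`-chains of `K` with coefficients in `A`: finite formal combinations
of `q`-simplices, each oriented by the order of its vertices. -/
abbrev PreAbstractSimplicialComplex.Chains (K : PreAbstractSimplicialComplex V)
    (A : Type*) [AddCommGroup A] (q : ℕ) : Type _ :=
  K.Simplex q →₀ A

/-- The simplicial boundary map: a simplex with vertices `v₀ < ⋯ < v_{q+1}` is sent to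
`∑ᵢ (-1)ⁱ [v₀, …, v̂ᵢ, …, v_{q+1}]`. The index `i` of a vertex `v` of `s` is the number of vertices
of `s` below `v`. -/
noncomputable def PreAbstractSimplicialComplex.boundary (K : PreAbstractSimplicialComplex V)
    (A : Type*) [AddCommGroup A] (q : ℕ) : K.Chains A (q + 1) →+ K.Chains A q :=
  Finsupp.liftAddHom fun s : K.Simplex (q + 1) =>
    ∑ v : {x // x ∈ s.1},
      ((-1 : ℤ) ^ (s.1.filter (fun w => w < v.1)).card) • Finsupp.singleAddHom (s.face v)

/-- The simplicial `q`-cycles of `K`; every `0`-chain is a cycle. -/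
noncomputable def PreAbstractSimplicialComplex.cycles (K : PreAbstractSimplicialComplex V)
    (A : Type*) [AddCommGroup A] : (q : ℕ) → AddSubgroup (K.Chains A q)
  | 0 => ⊤
  | q + 1 => (K.boundary A q).ker

/-- The simplicial `q`-boundaries of `K`. -/
noncomputable def PreAbstractSimplicialComplex.boundaries (K : PreAbstractSimplicialComplex V)
    (A : Type*) [AddCommGroup A] (q : ℕ) : AddSubgroup (K.Chains A q) :=
  (K.boundary A q).range

theorem PreAbstractSimplicialComplex.boundary_boundary (K : PreAbstractSimplicialComplex V)
    (A : Type*) [AddCommGroup A] (q : ℕ) (c : K.Chains A (q + 2)) :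
    K.boundary A q (K.boundary A (q + 1) c) = 0 := by
  classical
  suffices h : (K.boundary A q).comp (K.boundary A (q + 1)) = 0 from DFunLike.congr_fun h c
  refine Finsupp.addHom_ext fun s a => ?_
  simp only [AddMonoidHom.comp_apply, AddMonoidHom.zero_apply, boundary,
    Finsupp.liftAddHom_apply_single, AddMonoidHom.finsetSum_apply, AddMonoidHom.smul_apply,
    Finsupp.singleAddHom_apply, map_sum, map_zsmul, Finset.smul_sum, smul_smul]
  rw [Finset.sum_sigma']
  refine Finset.sum_involution
    (fun p _ => ⟨⟨p.2.1, Finset.mem_of_mem_erase p.2.2⟩,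
      ⟨p.1.1, Finset.mem_erase.2 ⟨(Finset.ne_of_mem_erase p.2.2).symm, p.1.2⟩⟩⟩) ?_ ?_ ?_ ?_
  · rintro ⟨⟨v, hv⟩, ⟨w, hw⟩⟩ -
    have hwv : w ≠ v := Finset.ne_of_mem_erase hw
    have hws : w ∈ s.1 := Finset.mem_of_mem_erase hw
    have hface : (s.face ⟨v, hv⟩).face ⟨w, hw⟩ =
        (s.face ⟨w, hws⟩).face ⟨v, Finset.mem_erase.2 ⟨hwv.symm, hv⟩⟩ :=
      Subtype.ext (Finset.erase_right_comm)
    rw [hface, ← add_smul]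
    have key : ∀ x y : V, x ∈ s.1 → y ∈ s.1 → x < y →
        ((s.1.filter (· < y)).card = ((s.1.erase x).filter (· < y)).card + 1) ∧
        (((s.1.erase y).filter (· < x)).card = (s.1.filter (· < x)).card) := by
      intro x y hx hy hxy
      constructor
      · rw [Finset.filter_erase, Finset.card_erase_add_one]
        exact Finset.mem_filter.2 ⟨hx, hxy⟩
      · rw [Finset.filter_erase, Finset.erase_eq_of_notMem]
        simp [hxy.le]
    have hz : ((-1 : ℤ) ^ (s.1.filter (· < v)).card * (-1) ^ ((s.1.erase v).filter (· < w)).card +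
        (-1) ^ (s.1.filter (· < w)).card * (-1) ^ ((s.1.erase w).filter (· < v)).card) = 0 := by
      rcases lt_or_gt_of_ne hwv with h | h
      · obtain ⟨h1, h2⟩ := key w v hws hv h
        rw [h1, h2]; ring
      · obtain ⟨h1, h2⟩ := key v w hv hws h
        rw [h1, h2]; ring
    exact (congrArg (· • _) hz).trans (zero_smul ℤ _)
  · rintro ⟨⟨v, hv⟩, ⟨w, hw⟩⟩ - - h
    exact Finset.ne_of_mem_erase hw (congrArg (fun p => p.1.1) h)
  · intro _ _; exact Finset.mem_univ _
  · intro _ _; rfl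

theorem PreAbstractSimplicialComplex.boundaries_le_cycles (K : PreAbstractSimplicialComplex V)
    (A : Type*) [AddCommGroup A] (q : ℕ) : K.boundaries A q ≤ K.cycles A q := by
  cases q with
  | zero => exact le_top
  | succ q =>
    rintro _ ⟨c, rfl⟩
    exact K.boundary_boundary A q c

/-- The `q`-th (unreduced) simplicial homology group `H_q(K; A)`: cycles modulo boundaries. -/
abbrev PreAbstractSimplicialComplex.Homology (K : PreAbstractSimplicialComplex V)
    (A : Type*) [AddCommGroup A] (q : ℕ) : Type _ :=
  K.cycles A q ⧸ (K.boundaries A q).addSubgroupOf (K.cycles A q)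

end SimplicialHomology

/-- The common neighbors in `G` of the vertices in `s`. -/
def SimpleGraph.commonNeighborsOf {V : Type*} (G : SimpleGraph V) (s : Finset V) : Set V :=
  {w | ∀ v ∈ s, G.Adj v w}

/-- The multineighbor complex `N_m(G)`: a nonempty finite set of vertices is a simplex if its
vertices have at least `m` common neighbors in `G`. -/
def SimpleGraph.multineighborComplex {V : Type*} (G : SimpleGraph V) (m : ℕ) :
    PreAbstractSimplicialComplex V where
  faces := {s | s.Nonempty ∧ (m : ℕ∞) ≤ (G.commonNeighborsOf s).encard}
  isRelLowerSet_faces := fun _ hs =>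
    ⟨hs.1, fun _ hts ht =>
      ⟨ht, hs.2.trans (Set.encard_le_encard fun _ hw v hv => hw v (hts hv))⟩⟩

/-!
A strict half graph of size `k` in `G` consists of distinct `x 0, …, x (k-1)` and distinct
`y 0, …, y (k-1)` with `x i` adjacent to `y j` for `j < i`. Two facts are combined.

* If `G` has no strict half graph of size `k`, then `H_q(N_m(G); A) = 0` for all `q ≥ k`
  (`SimpleGraph.subsingleton_homology_multineighborComplex`). Indeed `N_m(G)` is the union of the
  full simplices on the common neighborhoods `N(T)` with `|T| ≥ m`, a family closed under
  intersection. Adding one full simplex `F` at a time, Mayer–Vietoris reduces the vanishing of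
  degree `q` homology of the union to the vanishing of degree `q - 1` homology of the part covered
  by the proper subsets `F ∩ F'` (`PreAbstractSimplicialComplex.exists_boundary_eq_union`,
  `PreAbstractSimplicialComplex.exists_boundary_eq_of_depth`). So homology vanishes from the length
  of the longest strict chain of common neighborhoods on, and such a chain produces a half graph of
  the same size.

* The pairs `s(x i, y j)` with `j < i` of a half graph are pairwise distinct
  (`SimpleGraph.IsHalfGraph.injOn_edge`), so `G(n, 1/2)` contains a half graph of size `k` with
  probability at most `n ^ (2k) * 2 ^ (-k(k-1)/2)`. This is at most `2 ^ (-k)` once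
  `k ≥ 4 log₂ n + 3`, and `ε log₂ n` eventually absorbs both this constant and the shift by `m`.
-/

open MeasureTheory ProbabilityTheory Filter
open scoped ENNReal

/-! ### Homology of a complex covered by full simplices -/

namespace PreAbstractSimplicialComplex

section Chains

variable {V : Type*}

/-- The chains of `K` all of whose simplices belong to `P`. For a lower set `P` this is the chain
group of the subcomplex of `K` cut out by `P`. -/
def chainsOn (K : PreAbstractSimplicialComplex V) (A : Type*) [AddCommGroup A]
    (P : Set (Finset V)) (q : ℕ) : AddSubgroup (K.Chains A q) where
  carrier := {c | ∀ s, c s ≠ 0 → s.1 ∈ P}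
  zero_mem' := fun s hs => absurd rfl hs
  add_mem' := by
    intro c d hc hd s hs
    by_contra hP
    have h1 : c s = 0 := by_contra fun h => hP (hc s h)
    have h2 : d s = 0 := by_contra fun h => hP (hd s h)
    exact hs (by simp [h1, h2])
  neg_mem' := by
    intro c hc s hs
    exact hc s fun h => hs (by simp [h])

/-- The chain `a • s` if `s` is a `q`-simplex of `K`, and zero otherwise. -/
noncomputable def elementaryChain (K : PreAbstractSimplicialComplex V) (A : Type*) [AddCommGroup A]
    (q : ℕ) (s : Finset V) : A →+ K.Chains A q :=
  open Classical in
  if h : s ∈ K.faces ∧ s.card = q + 1 then Finsupp.singleAddHom ⟨s, h⟩ else 0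

variable {K : PreAbstractSimplicialComplex V} {A : Type*} [AddCommGroup A] {q : ℕ}
  {P Q : Set (Finset V)}

theorem chainsOn_mono (h : P ⊆ Q) : K.chainsOn A P q ≤ K.chainsOn A Q q :=
  fun _ hc s hs => h (hc s hs)

theorem elementaryChain_simplex (s : K.Simplex q) (a : A) :
    K.elementaryChain A q s.1 a = Finsupp.single s a := by
  rw [elementaryChain, dif_pos s.2]; rfl

theorem elementaryChain_mem_chainsOn {s : Finset V} (hs : s ∈ P) (a : A) :
    K.elementaryChain A q s a ∈ K.chainsOn A P q := by
  by_cases h : s ∈ K.faces ∧ s.card = q + 1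
  · intro t ht
    by_contra hP
    rw [elementaryChain_simplex (⟨s, h⟩ : K.Simplex q) a] at ht
    exact ht (Finsupp.single_eq_of_ne fun h' => hP (h' ▸ hs))
  · rw [elementaryChain, dif_neg h]
    exact zero_mem _

end Chains

variable {V : Type*} [LinearOrder V] {K : PreAbstractSimplicialComplex V} {A : Type*}
  [AddCommGroup A] {q : ℕ} {P Q : Set (Finset V)}

theorem boundary_elementaryChain {s : Finset V} (hs : s ∈ K.faces) (hc : s.card = q + 2) (a : A) :
    K.boundary A q (K.elementaryChain A (q + 1) s a) =
      ∑ v ∈ s, ((-1 : ℤ) ^ (s.filter (· < v)).card) • K.elementaryChain A q (s.erase v) a := by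
  rw [elementaryChain_simplex (⟨s, hs, hc⟩ : K.Simplex (q + 1)) a]
  refine (Finsupp.liftAddHom_apply_single _ _ _).trans ?_
  rw [AddMonoidHom.finsetSum_apply, ← Finset.sum_coe_sort s]
  refine Finset.sum_congr rfl fun v _ => ?_
  rw [AddMonoidHom.smul_apply, Finsupp.singleAddHom_apply, ← elementaryChain_simplex]
  rfl

theorem boundary_mem_chainsOn (hP : IsLowerSet P) {c : K.Chains A (q + 1)}
    (hc : c ∈ K.chainsOn A P (q + 1)) : K.boundary A q c ∈ K.chainsOn A P q := by
  rw [← Finsupp.sum_single c, Finsupp.sum, map_sum]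
  refine sum_mem fun s hs => ?_
  rw [← elementaryChain_simplex, boundary_elementaryChain s.2.1 s.2.2]
  refine sum_mem fun v _ => zsmul_mem (elementaryChain_mem_chainsOn ?_ _) _
  exact hP (Finset.erase_subset v s.1) (hc s (Finsupp.mem_support_iff.1 hs))

/-- The cone operator with apex `v`: it adds the vertex `v` to a simplex not containing it and
kills the simplices containing it. Simplices `s` for which `insert v s` is not in `K` are also
killed. -/
noncomputable def cone (K : PreAbstractSimplicialComplex V) (A : Type*) [AddCommGroup A]
    (v : V) (q : ℕ) : K.Chains A q →+ K.Chains A (q + 1) :=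
  Finsupp.liftAddHom fun s : K.Simplex q =>
    if v ∈ s.1 then 0 else K.elementaryChain A (q + 1) (insert v s.1)

theorem cone_elementaryChain (v : V) {s : Finset V} (hs : s ∈ K.faces) (hc : s.card = q + 1)
    (a : A) : K.cone A v q (K.elementaryChain A q s a) =
      if v ∈ s then 0 else K.elementaryChain A (q + 1) (insert v s) a := by
  rw [elementaryChain_simplex (⟨s, hs, hc⟩ : K.Simplex q) a]
  refine (Finsupp.liftAddHom_apply_single _ _ _).trans ?_
  split_ifs <;> rfl

/-- With the apex below all other vertices, the sign of every face of `insert v s` through `v` is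
opposite to that of the corresponding face of `s`, so the cone operator is a contracting homotopy
in positive degrees. -/
theorem boundary_cone_elementaryChain {v : V} {s : Finset V} (hs : insert v s ∈ K.faces)
    (hc : s.card = q + 2) (hv : ∀ w ∈ s, v ≤ w) (a : A) :
    K.boundary A (q + 1) (K.cone A v (q + 1) (K.elementaryChain A (q + 1) s a)) +
      K.cone A v q (K.boundary A q (K.elementaryChain A (q + 1) s a)) =
      K.elementaryChain A (q + 1) s a := by
  have hs0 : s.Nonempty := Finset.card_pos.1 (by omega)
  have hsK : s ∈ K.faces := (K.isRelLowerSet_faces hs).2 (Finset.subset_insert v s) hs0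
  have hcard : ∀ w ∈ s, (s.erase w).card = q + 1 := fun w hw => by
    rw [Finset.card_erase_of_mem hw, hc]; rfl
  have hface : ∀ w ∈ s, s.erase w ∈ K.faces := fun w hw =>
    (K.isRelLowerSet_faces hsK).2 (Finset.erase_subset w s)
      (Finset.card_pos.1 (by rw [hcard w hw]; omega))
  have hlow : s.filter (· < v) = ∅ :=
    Finset.filter_eq_empty_iff.2 fun w hw => not_lt.2 (hv w hw)
  rw [cone_elementaryChain v hsK hc, boundary_elementaryChain hsK hc, map_sum]
  by_cases hvs : v ∈ s
  · rw [if_pos hvs, map_zero, zero_add, Finset.sum_eq_single_of_mem v hvs]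
    · rw [map_zsmul, cone_elementaryChain v (hface v hvs) (hcard v hvs),
        if_neg (Finset.notMem_erase v s), Finset.insert_erase hvs, hlow]
      simp
    · intro w hw hwv
      rw [map_zsmul, cone_elementaryChain v (hface w hw) (hcard w hw),
        if_pos (Finset.mem_erase.2 ⟨hwv.symm, hvs⟩), smul_zero]
  · rw [if_neg hvs, boundary_elementaryChain hs (by rw [Finset.card_insert_of_notMem hvs, hc]),
      Finset.sum_insert hvs, Finset.erase_insert hvs, Finset.filter_insert, if_neg (lt_irrefl v),
      hlow, Finset.card_empty, pow_zero, one_smul, add_assoc, ← Finset.sum_add_distrib,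
      Finset.sum_eq_zero, add_zero]
    intro w hw
    have hne : v ≠ w := fun h => hvs (h ▸ hw)
    rw [map_zsmul, cone_elementaryChain v (hface w hw) (hcard w hw),
      if_neg fun h => hvs (Finset.mem_of_mem_erase h), Finset.filter_insert,
      if_pos (lt_of_le_of_ne (hv w hw) hne), Finset.card_insert_of_notMem 
        (fun h => hvs (Finset.mem_of_mem_filter v h)),
      Finset.erase_insert_of_ne hne, pow_succ, mul_neg_one, neg_smul, neg_add_cancel]

/-- A full simplex has no homology in positive degrees. -/
theorem exists_boundary_eq_of_mem_chainsOn_subsets {F : Finset V}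
    (hF : ∀ s ⊆ F, s.Nonempty → s ∈ K.faces) {z : K.Chains A (q + 1)}
    (hz : z ∈ K.cycles A (q + 1)) (hzF : z ∈ K.chainsOn A {s | s ⊆ F} (q + 1)) :
    ∃ w ∈ K.chainsOn A {s | s ⊆ F} (q + 2), K.boundary A (q + 1) w = z := by
  have hdec : z = ∑ s ∈ z.support, K.elementaryChain A (q + 1) s.1 (z s) := by
    simp only [elementaryChain_simplex]
    exact (Finsupp.sum_single z).symm
  rcases F.eq_empty_or_nonempty with rfl | hne
  · have h0 : z = 0 := by
      ext s
      by_contra h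
      have h1 := Finset.subset_empty.1 (hzF s h)
      have h2 := s.2.2
      simp [h1] at h2
    exact ⟨0, zero_mem _, by rw [map_zero, h0]⟩
  · set v := F.min' hne
    have hvF : v ∈ F := F.min'_mem hne
    have hsF : ∀ s ∈ z.support, s.1 ⊆ F := fun s hs => hzF s (Finsupp.mem_support_iff.1 hs)
    refine ⟨K.cone A v (q + 1) z, ?_, ?_⟩
    · rw [hdec, map_sum]
      refine sum_mem fun s hs => ?_
      rw [cone_elementaryChain v s.2.1 s.2.2]
      split_ifs
      · exact zero_mem _
      · exact elementaryChain_mem_chainsOn (Finset.insert_subset hvF (hsF s hs)) _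
    · have hz0 : K.boundary A q z = 0 := hz
      rw [← add_zero (K.boundary A (q + 1) _), ← map_zero (K.cone A v q), ← hz0]
      rw [hdec]
      simp only [map_sum]
      rw [← Finset.sum_add_distrib]
      refine Finset.sum_congr rfl fun s hs => ?_
      have h := boundary_cone_elementaryChain (K := K) (v := v) (s := s.1) (q := q)
        (hF _ (Finset.insert_subset hvF (hsF s hs)) (Finset.insert_nonempty _ _)) s.2.2
        (fun w hw => F.min'_le w (hsF s hs hw)) (z s)
      simpa only [map_sum] using h

/-- A Mayer–Vietoris step: if two subcomplexes have no homology in degree `q + 1`, and their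
intersection has none in degree `q`, then their union has none in degree `q + 1`. -/
theorem exists_boundary_eq_union (hP : IsLowerSet P) (hQ : IsLowerSet Q)
    (hP' : ∀ z ∈ K.cycles A (q + 1), z ∈ K.chainsOn A P (q + 1) →
      ∃ w ∈ K.chainsOn A P (q + 2), K.boundary A (q + 1) w = z)
    (hQ' : ∀ z ∈ K.cycles A (q + 1), z ∈ K.chainsOn A Q (q + 1) →
      ∃ w ∈ K.chainsOn A Q (q + 2), K.boundary A (q + 1) w = z)
    (hPQ : ∀ z ∈ K.cycles A q, z ∈ K.chainsOn A (P ∩ Q) q →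
      ∃ w ∈ K.chainsOn A (P ∩ Q) (q + 1), K.boundary A q w = z)
    {z : K.Chains A (q + 1)} (hz : z ∈ K.cycles A (q + 1))
    (hzPQ : z ∈ K.chainsOn A (P ∪ Q) (q + 1)) :
    ∃ w ∈ K.chainsOn A (P ∪ Q) (q + 2), K.boundary A (q + 1) w = z := by
  classical
  set a := z.filter (fun s => s.1 ∈ P)
  set b := z.filter (fun s => ¬ s.1 ∈ P) with hb
  have hab : a + b = z := Finsupp.filter_add_filter_not z _
  have haP : a ∈ K.chainsOn A P (q + 1) := fun s hs => by
    by_contra h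
    exact hs (Finsupp.filter_apply_neg _ _ h)
  have hbQ : b ∈ K.chainsOn A Q (q + 1) := fun s hs => by
    by_cases h : s.1 ∈ P
    · exact absurd (Finsupp.filter_apply_neg (fun s : K.Simplex (q + 1) => ¬ s.1 ∈ P) z
        (not_not.2 h)) hs
    · rw [hb, Finsupp.filter_apply_pos (fun s : K.Simplex (q + 1) => ¬ s.1 ∈ P) _ h] at hs
      exact (hzPQ s hs).resolve_left h
  have hz0 : K.boundary A q a + K.boundary A q b = 0 := by
    rw [← map_add, hab]; exact hz
  -- `∂a = -∂b` is a cycle of the intersection, so it bounds some `e` there, and `z` is the sum of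
  -- the cycles `a - e` of `P` and `b + e` of `Q`.
  obtain ⟨e, he, hea⟩ := hPQ (K.boundary A q a) (K.boundaries_le_cycles A q ⟨a, rfl⟩) (by
    intro s hs
    refine ⟨boundary_mem_chainsOn hP haP s hs, ?_⟩
    rw [eq_neg_of_add_eq_zero_left hz0] at hs
    exact neg_mem (boundary_mem_chainsOn hQ hbQ) s hs)
  obtain ⟨w₁, hw₁, h₁⟩ := hP' (a - e)
    (by change K.boundary A q (a - e) = 0; rw [map_sub, hea, sub_self])
    (sub_mem haP (chainsOn_mono Set.inter_subset_left he))
  obtain ⟨w₂, hw₂, h₂⟩ := hQ' (b + e)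
    (by change K.boundary A q (b + e) = 0; rw [map_add, hea, add_comm, hz0])
    (add_mem hbQ (chainsOn_mono Set.inter_subset_right he))
  refine ⟨w₁ + w₂, add_mem (chainsOn_mono Set.subset_union_left hw₁)
    (chainsOn_mono Set.subset_union_right hw₂), ?_⟩
  rw [map_add, h₁, h₂, ← hab]
  abel

/-- The subcomplex covered by full simplices `F ∈ 𝓕` has no homology in degrees `q ≥ r`, if the
strictly descending chains obtained from `𝓕` by intersecting have fewer than `r` steps. The bound on
these chains is encoded by a predicate `D r F`, saying that fewer than `r` steps remain possible
from `F` on. -/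
theorem exists_boundary_eq_of_depth {D : ℕ → Finset V → Prop}
    (hK : ∀ r F, D r F → ∀ s ⊆ F, s.Nonempty → s ∈ K.faces)
    (h0 : ∀ F, ¬ D 0 F)
    (hD : ∀ r F F', D (r + 1) F → D (r + 1) F' → ¬ F ⊆ F' → D r (F ∩ F'))
    (r : ℕ) : ∀ q, r ≤ q → ∀ 𝓕 : Finset (Finset V), (∀ F ∈ 𝓕, D r F) →
      ∀ z ∈ K.cycles A q, z ∈ K.chainsOn A {s | ∃ F ∈ 𝓕, s ⊆ F} q →
      ∃ w ∈ K.chainsOn A {s | ∃ F ∈ 𝓕, s ⊆ F} (q + 1), K.boundary A q w = z := by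
  have hempty : ∀ (q : ℕ) (z : K.Chains A q),
      z ∈ K.chainsOn A {s | ∃ F ∈ (∅ : Finset (Finset V)), s ⊆ F} q → z = 0 := by
    intro q z hz
    ext s
    by_contra h
    obtain ⟨F, hF, -⟩ := hz s h
    exact Finset.notMem_empty F hF
  induction r with
  | zero =>
    intro q _ 𝓕 h𝓕 z _ hz
    obtain rfl : 𝓕 = ∅ := Finset.eq_empty_of_forall_notMem fun F hF => h0 F (h𝓕 F hF)
    exact ⟨0, zero_mem _, by rw [map_zero, hempty q z hz]⟩
  | succ r ih =>
    intro q hq 𝓕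
    obtain ⟨q, rfl⟩ : ∃ q', q = q' + 1 := ⟨q - 1, by omega⟩
    induction 𝓕 using Finset.induction_on with
    | empty =>
      intro _ z _ hz
      exact ⟨0, zero_mem _, by rw [map_zero, hempty _ z hz]⟩
    | insert F 𝓕 _ ih𝓕 =>
      intro h𝓕 z hz hzF
      have h𝓕' : ∀ F' ∈ 𝓕, D (r + 1) F' := fun F' hF' => h𝓕 F' (Finset.mem_insert_of_mem hF')
      have hFD : D (r + 1) F := h𝓕 F (Finset.mem_insert_self F 𝓕)
      have hun : {s : Finset V | ∃ F' ∈ insert F 𝓕, s ⊆ F'} =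
          {s | s ⊆ F} ∪ {s | ∃ F' ∈ 𝓕, s ⊆ F'} := by
        ext s; simp
      rw [hun] at hzF ⊢
      by_cases hsub : ∃ F' ∈ 𝓕, F ⊆ F'
      · obtain ⟨F', hF', hFF'⟩ := hsub
        have h : {s | s ⊆ F} ∪ {s | ∃ F' ∈ 𝓕, s ⊆ F'} = {s | ∃ F' ∈ 𝓕, s ⊆ F'} :=
          Set.union_eq_right.2 fun s hs => ⟨F', hF', Finset.Subset.trans hs hFF'⟩
        rw [h] at hzF ⊢
        exact ih𝓕 h𝓕' z hz hzF
      · push Not at hsub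
        have hl : IsLowerSet {s | s ⊆ F} := fun s t hts hs => Finset.Subset.trans hts hs
        have hl' : IsLowerSet {s | ∃ F' ∈ 𝓕, s ⊆ F'} := by
          rintro s t hts ⟨F', hF', hs⟩
          exact ⟨F', hF', Finset.Subset.trans hts hs⟩
        refine exists_boundary_eq_union hl hl'
          (fun z hz hzF => exists_boundary_eq_of_mem_chainsOn_subsets (hK _ F hFD) hz hzF)
          (fun z hz hzF => ih𝓕 h𝓕' z hz hzF) ?_ hz hzF
        have hinter : {s | s ⊆ F} ∩ {s | ∃ F' ∈ 𝓕, s ⊆ F'} =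
            {s | ∃ F' ∈ 𝓕.image (F ∩ ·), s ⊆ F'} := by
          ext s
          simp only [Set.mem_inter_iff, Set.mem_ofPred_eq, Finset.mem_image,
            exists_exists_and_eq_and, Finset.subset_inter_iff]
          tauto
        rw [hinter]
        refine ih q (by omega) _ fun G hG => ?_
        obtain ⟨F', hF', rfl⟩ := Finset.mem_image.1 hG
        exact hD r F F' hFD (h𝓕' F' hF') (hsub F' hF')

theorem subsingleton_homology (h : ∀ z ∈ K.cycles A q, ∃ w, K.boundary A q w = z) :
    Subsingleton (K.Homology A q) := by
  rw [QuotientAddGroup.subsingleton_iff, AddSubgroup.addSubgroupOf_eq_top]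
  intro z hz
  obtain ⟨w, hw⟩ := h z hz
  exact ⟨w, hw⟩

end PreAbstractSimplicialComplex

/-! ### Half graphs and the multineighbor complex -/

namespace SimpleGraph

/-- `x` and `y` span a strict half graph of size `k` in `G`: the `x i` with `i < k` are distinct, so
are the `y i`, and `x i` is adjacent to `y j` whenever `j < i`. Values at indices `≥ k` are
irrelevant, and some `x i` may coincide with some `y j`. -/
structure IsHalfGraph {V : Type*} (G : SimpleGraph V) (k : ℕ) (x y : ℕ → V) : Prop where
  injOn_left : Set.InjOn x (Set.Iio k)
  injOn_right : Set.InjOn y (Set.Iio k)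
  adj : ∀ i j, j < i → i < k → G.Adj (x i) (y j)

/-- A half graph grows by one if its new left vertex `a` differs from the old ones and is adjacent
to the old right vertices, and its new right vertex `b` differs from the old ones. -/
theorem IsHalfGraph.update {V : Type*} {G : SimpleGraph V} {k : ℕ} {x y : ℕ → V}
    (h : G.IsHalfGraph k x y) {a b : V} (ha : ∀ i < k, x i ≠ a) (hb : ∀ i < k, y i ≠ b)
    (hadj : ∀ i < k, G.Adj a (y i)) :
    G.IsHalfGraph (k + 1) (Function.update x k a) (Function.update y k b) := by
  have key : ∀ (z : ℕ → V) (c : V), Set.InjOn z (Set.Iio k) → (∀ i < k, z i ≠ c) →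
      Set.InjOn (Function.update z k c) (Set.Iio (k + 1)) := by
    intro z c hz hc i hi j hj hij
    have hi' := Set.mem_Iio.1 hi
    have hj' := Set.mem_Iio.1 hj
    simp only [Function.update_apply] at hij
    split_ifs at hij with h1 h2 h2
    · omega
    · exact absurd hij.symm (hc j (by omega))
    · exact absurd hij (hc i (by omega))
    · exact hz (Set.mem_Iio.2 (by omega)) (Set.mem_Iio.2 (by omega)) hij
  refine ⟨key x a h.injOn_left ha, key y b h.injOn_right hb, fun i j hji hi => ?_⟩
  rw [Function.update_of_ne (by omega : j ≠ k)]
  rcases eq_or_ne i k with rfl | hik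
  · rw [Function.update_self]; exact hadj j hji
  · rw [Function.update_of_ne hik]; exact h.adj i j hji (by omega)

/-- The simplices of `N_m(G)` are the nonempty subsets of the sets `N(T)` with `|T| ≥ m`. A strictly
descending chain `F₀ ⊋ F₁ ⊋ ⋯` of such sets yields a half graph by choosing `x i ∈ F i \ F (i+1)`
and `y i ∈ N(F (i+1)) \ N(F i)`. Hence without half graphs of size `k` there are fewer than `k`
steps in such a chain, and the homology vanishes from degree `k` on. -/
theorem subsingleton_homology_multineighborComplex {V : Type*} [LinearOrder V] [Fintype V]
    [Nonempty V] (G : SimpleGraph V) (m : ℕ) (A : Type*) [AddCommGroup A] {k q : ℕ} (hkq : k ≤ q)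
    (hG : ∀ x y : ℕ → V, ¬ G.IsHalfGraph k x y) :
    Subsingleton ((G.multineighborComplex m).Homology A q) := by
  classical
  set N : Finset V → Finset V := fun T => Finset.univ.filter fun v => ∀ w ∈ T, G.Adj v w with hN
  have hmemN : ∀ T v, v ∈ N T ↔ ∀ w ∈ T, G.Adj v w := by simp [hN]
  -- `D r F`: the set `F` ends a descending chain that provides a half graph of size `k - r`.
  set D : ℕ → Finset V → Prop := fun r F =>
    (∃ T : Finset V, m ≤ T.card ∧ F = N T) ∧
    ∃ j, j + r = k ∧ ∃ x y, G.IsHalfGraph j x y ∧ (∀ i < j, x i ∉ F) ∧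
      ∀ i < j, ∀ v ∈ F, G.Adj v (y i)
  refine PreAbstractSimplicialComplex.subsingleton_homology fun z hz => ?_
  refine (PreAbstractSimplicialComplex.exists_boundary_eq_of_depth (A := A)
    (K := G.multineighborComplex m) (D := D) ?_ ?_ ?_ k q hkq
    ((Finset.univ.filter fun T : Finset V => m ≤ T.card).image N) ?_ z hz ?_).imp
    fun _ hw => hw.2
  · rintro r F ⟨⟨T, hT, rfl⟩, -⟩ s hs hs0
    refine ⟨hs0, le_trans ?_ (Set.encard_le_encard (s := (T : Set V)) ?_)⟩
    · rw [Set.encard_coe_eq_coe_finsetCard]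
      exact_mod_cast hT
    · exact fun w hw v hv => (hmemN T v).1 (hs hv) w hw
  · rintro F ⟨-, j, hj, x, y, hxy, -⟩
    obtain rfl : j = k := by omega
    exact hG x y hxy
  · rintro r F F' ⟨⟨T, hT, rfl⟩, j, hj, x, y, hxy, hx, hy⟩ ⟨⟨T', hT', rfl⟩, -⟩ hsub
    refine ⟨⟨T ∪ T', hT.trans (Finset.card_le_card Finset.subset_union_left), ?_⟩, j + 1, by omega,
      ?_⟩
    · ext v
      simp only [Finset.mem_inter, hmemN, Finset.mem_union]
      grind
    · obtain ⟨a, ha, ha'⟩ := Finset.not_subset.1 hsub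
      obtain ⟨b, hb, hab⟩ : ∃ b ∈ T', ¬ G.Adj a b := by
        by_contra! h
        exact ha' ((hmemN T' a).2 h)
      refine ⟨Function.update x j a, Function.update y j b,
        hxy.update (fun i hi h => hx i hi (h ▸ ha)) (fun i hi h => hab (h ▸ hy i hi a ha))
          fun i hi => hy i hi a ha, ?_, ?_⟩
      · intro i hi hmem
        rcases eq_or_ne i j with rfl | hij
        · rw [Function.update_self] at hmem
          exact ha' (Finset.mem_inter.1 hmem).2
        · rw [Function.update_of_ne hij] at hmem
          exact hx i (by omega) (Finset.mem_inter.1 hmem).1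
      · intro i hi v hv
        rw [Finset.mem_inter] at hv
        rcases eq_or_ne i j with rfl | hij
        · rw [Function.update_self]
          exact (hmemN T' v).1 hv.2 b hb
        · rw [Function.update_of_ne hij]
          exact hy i (by omega) v hv.1
  · intro F hF
    obtain ⟨T, hT, rfl⟩ := Finset.mem_image.1 hF
    obtain ⟨v⟩ := ‹Nonempty V›
    refine ⟨⟨T, (Finset.mem_filter.1 hT).2, rfl⟩, 0, zero_add k, fun _ => v, fun _ => v,
      ⟨?_, ?_, ?_⟩, ?_, ?_⟩ <;> simp
  · intro s _
    obtain ⟨-, hs⟩ := s.2.1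
    refine ⟨_, Finset.mem_image_of_mem N (Finset.mem_filter.2
      ⟨Finset.mem_univ (Set.toFinset (G.commonNeighborsOf s.1)), ?_⟩), fun v hv => ?_⟩
    · rw [Set.encard_eq_coe_toFinset_card] at hs
      exact_mod_cast hs
    · rw [hmemN]
      intro w hw
      exact (Set.mem_toFinset.1 hw) v hv

end SimpleGraph

/-! ### Half graphs in the binomial random graph -/

namespace SimpleGraph

/-- In `G(V, p)`, a finite set of `N` pairs is contained in the edge set with probability at most
`p ^ N` (exactly `p ^ N` if no pair is degenerate). -/
theorem binomialRandom_edges_le {V : Type*} [Countable V] (p : unitInterval)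
    (E : Finset (Sym2 V)) :
    binomialRandom V p {G | (E : Set (Sym2 V)) ⊆ G.edgeSet} ≤
      ENNReal.ofReal p ^ E.card := by
  classical
  rw [binomialRandom_apply]
  refine (measure_mono (t := Set.pi E fun _ => {True}) ?_).trans ?_
  · rintro _ ⟨G, hG, rfl⟩ e he
    simpa using hG he
  · rw [Measure.infinitePi_pi _ (fun _ _ => MeasurableSet.of_discrete), ← Finset.prod_const]
    refine Finset.prod_le_prod' fun e _ => ?_
    have hp : ((unitInterval.toNNReal p : NNReal) : ℝ≥0∞) = ENNReal.ofReal p := by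
      rw [ENNReal.ofReal, Real.toNNReal_of_nonneg p.2.1]; rfl
    rw [← hp]
    by_cases he : e.IsDiag <;> simp [he]

/-- The pairs `s(x i, y j)` with `j < i` are distinct, even if some `x i` equals some `y l`: in that
case `i ≤ l`, since otherwise `x i` and `y l` would be adjacent, so `s(x i, y j) = s(x i', y j')`
with `x i = y j'` and `x i' = y j` would give `i ≤ j' < i' ≤ j < i`. -/
theorem IsHalfGraph.injOn_edge {V : Type*} {G : SimpleGraph V} {k : ℕ} {x y : ℕ → V}
    (h : G.IsHalfGraph k x y) :
    Set.InjOn (fun e : (_ : ℕ) × ℕ => s(x e.1, y e.2))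
      ((Finset.range k).sigma Finset.range : Finset _) := by
  have hne : ∀ i l, i < k → x i = y l → i ≤ l := fun i l hi hil => by
    by_contra! hli
    exact G.ne_of_adj (h.adj i l hli hi) hil
  rintro ⟨i, j⟩ hij ⟨i', j'⟩ hij' heq
  simp only [Finset.coe_sigma, Set.mem_sigma_iff, Finset.coe_range, Set.mem_Iio] at hij hij'
  rcases Sym2.eq_iff.1 heq with ⟨h1, h2⟩ | ⟨h1, h2⟩
  · obtain rfl := h.injOn_left hij.1 hij'.1 h1
    obtain rfl := h.injOn_right (Set.mem_Iio.2 (hij.2.trans hij.1))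
      (Set.mem_Iio.2 (hij'.2.trans hij.1)) h2
    rfl
  · have := hne i j' hij.1 h1
    have := hne i' j hij'.1 h2.symm
    omega

theorem binomialRandom_isHalfGraph_le {V : Type*} [Countable V] (p : unitInterval) (k : ℕ)
    (x y : ℕ → V) :
    binomialRandom V p {G | G.IsHalfGraph k x y} ≤ ENNReal.ofReal p ^ (k * (k - 1) / 2) := by
  classical
  rcases Set.eq_empty_or_nonempty {G : SimpleGraph V | G.IsHalfGraph k x y} with h | ⟨G₀, h₀⟩
  · simp [h]
  · set S : Finset ((_ : ℕ) × ℕ) := (Finset.range k).sigma Finset.range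
    have hcard : (S.image fun e => s(x e.1, y e.2)).card = k * (k - 1) / 2 := by
      rw [Finset.card_image_of_injOn (IsHalfGraph.injOn_edge h₀), Finset.card_sigma]
      simp [Finset.sum_range_id]
    rw [← hcard]
    refine (measure_mono fun G hG => ?_).trans (binomialRandom_edges_le p _)
    intro e he
    obtain ⟨⟨i, j⟩, hij, rfl⟩ := Finset.mem_image.1 (Finset.mem_coe.1 he)
    rw [Finset.mem_sigma, Finset.mem_range, Finset.mem_range] at hij
    exact hG.adj i j hij.2 hij.1

/-- The union bound over the `(n ^ k) ^ 2` possible vertex sequences. -/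
theorem binomialRandom_exists_isHalfGraph_le {V : Type*} [Fintype V] [Nonempty V]
    (p : unitInterval) (k : ℕ) :
    binomialRandom V p {G | ∃ x y, G.IsHalfGraph k x y} ≤
      ENNReal.ofReal (((Fintype.card V : ℝ) ^ k) ^ 2 * (p : ℝ) ^ (k * (k - 1) / 2)) := by
  classical
  set ext : (Fin k → V) → ℕ → V :=
    fun f i => if h : i < k then f ⟨i, h⟩ else Classical.arbitrary V with hext
  have hsub : {G : SimpleGraph V | ∃ x y, G.IsHalfGraph k x y} ⊆
      ⋃ f : (Fin k → V) × (Fin k → V), {G | G.IsHalfGraph k (ext f.1) (ext f.2)} := by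
    rintro G ⟨x, y, h⟩
    have he : ∀ z : ℕ → V, Set.EqOn z (ext fun i => z i) (Set.Iio k) := fun z i hi => by
      simp [hext, Set.mem_Iio.1 hi]
    refine Set.mem_iUnion.2 ⟨(fun i => x i, fun i => y i), h.injOn_left.congr (he x),
      h.injOn_right.congr (he y), fun i j hji hi => ?_⟩
    rw [← he x (Set.mem_Iio.2 hi), ← he y (Set.mem_Iio.2 (hji.trans hi))]
    exact h.adj i j hji hi
  refine (measure_mono hsub).trans ((measure_iUnion_fintype_le _ _).trans
    ((Finset.sum_le_sum fun f _ => binomialRandom_isHalfGraph_le p k _ _).trans (le_of_eq ?_)))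
  rw [Finset.sum_const, Finset.card_univ, Fintype.card_prod, Fintype.card_fun, Fintype.card_fin,
    ENNReal.ofReal_mul (by positivity), ← ENNReal.ofReal_pow p.2.1, nsmul_eq_mul, ← sq]
  congr 1
  rw [← Nat.cast_pow, ← Nat.cast_pow, ENNReal.ofReal_natCast]

end SimpleGraph

/-! ### The asymptotic estimate -/

/-- If `k` exceeds `4 log₂ n` by at least `3`, the expected number of half graphs of size `k` in
`G(n, 1/2)` is at most `2 ^ (-k)`. -/
theorem pow_mul_half_pow_le {n k : ℕ} (hn : 0 < n) (hk : 4 * Real.logb 2 n + 3 ≤ k) :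
    ((n : ℝ) ^ k) ^ 2 * (1 / 2 : ℝ) ^ (k * (k - 1) / 2) ≤ (1 / 2) ^ k := by
  have hn' : (0 : ℝ) < n := by exact_mod_cast hn
  set L := Real.logb 2 n
  have hnL : (n : ℝ) = 2 ^ L := (Real.rpow_logb two_pos (by norm_num) hn').symm
  have hN : ((k * (k - 1) / 2 : ℕ) : ℝ) = k * (k - 1) / 2 := by
    rw [← Nat.choose_two_right, Nat.cast_choose_two]
  have hhalf : ∀ N : ℕ, (1 / 2 : ℝ) ^ N = 2 ^ (-(N : ℝ)) := fun N => by
    rw [Real.rpow_neg two_pos.le, Real.rpow_natCast, one_div, inv_pow]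
  rw [hhalf, hhalf, hN, hnL, ← pow_mul, ← Real.rpow_natCast, ← Real.rpow_mul two_pos.le,
    ← Real.rpow_add two_pos]
  refine Real.rpow_le_rpow_of_exponent_le one_le_two ?_
  push_cast
  nlinarith [mul_le_mul_of_nonneg_left hk (Nat.cast_nonneg k : (0 : ℝ) ≤ k)]

theorem proposition2 (A : Type*) [AddCommGroup A] (m : ℕ) (ε : ℝ) (hε : 0 < ε) :
    Filter.Tendsto
      (fun n : ℕ =>
        SimpleGraph.binomialRandom (Fin n) (⟨1 / 2, by norm_num, by norm_num⟩ : unitInterval)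
          {G : SimpleGraph (Fin n) |
            ∀ l k : ℕ, (4 + ε) * Real.logb 2 n ≤ l → (k : ℤ) = (l : ℤ) - m + 1 →
              Subsingleton ((G.multineighborComplex m).Homology A k)})
      Filter.atTop (nhds 1) := by
  -- Since `l ≥ (4 + ε) log₂ n` is an integer, the degree `l - m + 1` is at least `f n`.
  set f : ℕ → ℕ := fun n => ⌈(4 + ε) * Real.logb 2 n⌉₊ - m with hf
  have hlog : Tendsto (fun n : ℕ => Real.logb 2 n) atTop atTop :=
    (Real.tendsto_logb_atTop one_lt_two).comp tendsto_natCast_atTop_atTop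
  have hbig : ∀ᶠ n : ℕ in atTop, 4 * Real.logb 2 n + 3 ≤ f n := by
    filter_upwards [hlog.eventually_ge_atTop ((m + 3) / ε)] with n hn
    have h1 := Nat.le_ceil ((4 + ε) * Real.logb 2 n)
    have h2 : (⌈(4 + ε) * Real.logb 2 n⌉₊ : ℝ) ≤ f n + m := by
      exact_mod_cast Nat.sub_le_iff_le_add.1 le_rfl
    rw [div_le_iff₀ hε] at hn
    linarith
  have hftop : Tendsto f atTop atTop := by
    rw [← tendsto_natCast_atTop_iff (R := ℝ)]
    exact tendsto_atTop_mono' _ hbig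
      (tendsto_atTop_add_const_right _ _ (hlog.const_mul_atTop (by norm_num)))
  have hlow : Tendsto (fun n => 1 - ENNReal.ofReal ((1 / 2) ^ f n)) atTop (nhds 1) := by
    have h0 : Tendsto (fun n => ENNReal.ofReal ((1 / 2 : ℝ) ^ f n)) atTop (nhds 0) := by
      rw [← ENNReal.ofReal_zero]
      exact (ENNReal.continuous_ofReal.tendsto 0).comp
        ((tendsto_pow_atTop_nhds_zero_of_lt_one (by norm_num) (by norm_num)).comp hftop)
    simpa using ENNReal.Tendsto.sub tendsto_const_nhds h0 (Or.inl ENNReal.one_ne_top)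
  refine tendsto_of_tendsto_of_tendsto_of_le_of_le' hlow tendsto_const_nhds ?_
    (Eventually.of_forall fun n => prob_le_one)
  filter_upwards [hbig, eventually_gt_atTop 0] with n hn hn0
  have : Nonempty (Fin n) := ⟨⟨0, hn0⟩⟩
  set p : unitInterval := ⟨1 / 2, by norm_num, by norm_num⟩
  have hbad : SimpleGraph.binomialRandom (Fin n) p {G | ∃ x y, G.IsHalfGraph (f n) x y} ≤
      ENNReal.ofReal ((1 / 2) ^ f n) := by
    refine (SimpleGraph.binomialRandom_exists_isHalfGraph_le p (f n)).trans
      (ENNReal.ofReal_le_ofReal ?_)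
    rw [Fintype.card_fin]
    exact pow_mul_half_pow_le hn0 hn
  rw [tsub_le_iff_right, ← measure_univ (μ := SimpleGraph.binomialRandom (Fin n) p)]
  refine (measure_mono fun G _ => ?_).trans
    ((measure_union_le _ _).trans (add_le_add_right hbad _))
  by_cases hG : ∃ x y, G.IsHalfGraph (f n) x y
  · exact Or.inr hG
  · push Not at hG
    refine Or.inl fun l k hl hk => ?_
    refine G.subsingleton_homology_multineighborComplex m A (k := f n) ?_ hG
    have := Nat.ceil_le.2 hl
    simp only [hf]
    omega
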